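/- Let $L$ be an even positive integer, $\beta=L^2$, let $M\ge 1$ be an integer, put $N'=L(M-1)$, and let $y$ be a non-zero complex number (for instance $|y|=1$). For an $L$-element set $\mathfrak u=\{\mathfrak u(1)<\dots<\mathfrak u(L)\}\subset[N')=\{0,1,\dots,N'-1\}$ put $$\delta\mathfrak u=\sum_{k=1}^L\mathfrak u(k)-\frac{L(N'-1)}2,\qquad \widetilde\Delta\mathfrak u=\prod_{1\le j<k\le L}\frac{\mathfrak u(k)-\mathfrak u(j)}{k-j},\qquad \mathbf e_{\mathfrak u}=\mathbf e_{\mathfrak u(1)}\wedge\dots\wedge\mathbf e_{\mathfrak u(L)}\in\Lambda^L\mathbb C^{N'},$$ where $\mathbf e_0,\dots,\mathbf e_{N'-1}$ is the standard basis of $\mathbb C^{N'}$. For $\omega\in\Lambda^L\mathbb C^{N'}$ let the hyperpfaffian $\mathrm{PF}(\omega)$ be the coefficient of $\mathbf e_0\wedge\dots\wedge\mathbf e_{N'-1}$ in $\omega^{\wedge(M-1)}/(M-1)!$. Then $$\mathrm{PF}\Bigl(\sum_{|\delta\mathfrak u|\le\beta/2}\binom{\beta}{\delta\mathfrak u+\beta/2}(-y)^{\delta\mathfrak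 u}\,\widetilde\Delta\mathfrak u\,\mathbf e_{\mathfrak u}\Bigr)=\frac1{(M-1)!}\binom{\beta M/2}{\beta/2,\dots,\beta/2},$$ or, in the normalisation with $(-y)^{\delta\mathfrak u+\beta/2}$ in place of $(-y)^{\delta\mathfrak u}$, $$\mathrm{PF}\Bigl(\sum_{|\delta\mathfrak u|\le\beta/2}\binom{\beta}{\delta\mathfrak u+\beta/2}(-y)^{\delta\mathfrak u+\beta/2}\,\widetilde\Delta\mathfrak u\,\mathbf e_{\mathfrak u}\Bigr)=\frac1{(M-1)!}\binom{\beta M/2}{\beta/2,\dots,\beta/2}\,y^{\beta(M-1)/2}.$$ Both sums are over all $L$-element $\mathfrak u\subset[N')$ with $|\delta\mathfrak u|\le\beta/2$, and the multinomial coefficient has $M$ lower entries, so that it equals $(\beta M/2)!/((\beta/2)!)^M$. -/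

import Mathlib

open scoped Nat

/-- The sum `Σ𝔱` of the elements of an `L`-element set `𝔱 ⊆ {0, …, N - 1}`. -/
def indexSum {N L : ℕ} (t : Set.powersetCard (Fin N) L) : ℤ :=
  ∑ k : Fin L, ((Set.powersetCard.ofFinEmbEquiv.symm t k : ℕ) : ℤ)

/-- `δ𝔱 = Σ𝔱 - L (N - 1) / 2`. The division is exact when `L` is even. -/
def centredSum {N L : ℕ} (t : Set.powersetCard (Fin N) L) : ℤ :=
  indexSum t - (L : ℤ) * ((N : ℤ) - 1) / 2

/-- The normalised Vandermonde product `∏_{j < k} (𝔱(k) - 𝔱(j)) / (k - j)`, where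
`𝔱(0) < 𝔱(1) < ⋯ < 𝔱(L - 1)` are the elements of `𝔱`. -/
noncomputable def normVandermonde {N L : ℕ} (t : Set.powersetCard (Fin N) L) : ℂ :=
  ∏ k : Fin L, ∏ j ∈ Finset.Iio k,
    (((Set.powersetCard.ofFinEmbEquiv.symm t k : ℕ) : ℂ) -
        ((Set.powersetCard.ofFinEmbEquiv.symm t j : ℕ) : ℂ)) /
      (((k : ℕ) : ℂ) - ((j : ℕ) : ℂ))

/-- The basis `L`-vector `e_𝔱 = e_{𝔱(0)} ∧ ⋯ ∧ e_{𝔱(L - 1)}` of `Λ^L ℂ^N`. -/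
noncomputable def basisBlade {N L : ℕ} (t : Set.powersetCard (Fin N) L) :
    ⋀[ℂ]^L (Fin N → ℂ) :=
  exteriorPower.ιMulti_family ℂ L (Pi.basisFun ℂ (Fin N)) t

/-- The coefficient of the volume form `e_0 ∧ ⋯ ∧ e_{N - 1}` in an element of the exterior algebra
of `ℂ^N`; on `Λ^N ℂ^N` this is the Hodge star `Λ^N ℂ^N → Λ^0 ℂ^N = ℂ`. -/
noncomputable def volumeCoeff {N : ℕ} (α : ExteriorAlgebra ℂ (Fin N → ℂ)) : ℂ :=
  (Pi.basisFun ℂ (Fin N)).ExteriorAlgebra.repr α Finset.univ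

/-- The hyperpfaffian `PF(ω) = ∗ (ω^{∧K} / K!)` of an `L`-vector `ω` over `ℂ^{LK}`. -/
noncomputable def hyperpfaffian (L K : ℕ) (ω : ⋀[ℂ]^L (Fin (L * K) → ℂ)) : ℂ :=
  volumeCoeff (((K ! : ℂ)⁻¹) • (ω : ExteriorAlgebra ℂ (Fin (L * K) → ℂ)) ^ K)

/-!
Let `ω(x) = γ(x) ∧ γ'(x)/1! ∧ ⋯ ∧ γ^(L-1)(x)/(L-1)!` be the osculating `L`-vector of the moment
curve `γ(x) = (1, x, …, x^(N'-1))`, and write `K = M - 1`, `β = L²`. The coordinate of `ω(x)` at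
`e_𝔲` is the normalised Vandermonde product of `𝔲` times a power of `x`, so the `L`-vector of the
theorem, with `(-y)^(δ𝔲 + β/2)`, is the coefficient of `x^(Kβ/2)` in `(x - y)^β ω(x)`.

By the confluent Vandermonde determinant, `ω(x_1) ∧ ⋯ ∧ ω(x_K)` is `∏_{i < j} (x_j - x_i)^β` times
the volume form. Hence `K! · PF` is the coefficient of `∏ x_i^(Kβ/2)` in
`∏_{i < j} (x_j - x_i)^β ∏_i (x_i - y)^β`. As `β/2` is even, this is the Dyson product in the `M`
variables `y, x_1, …, x_K` with all exponents equal to `β/2`, and by homogeneity Dyson's constant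
term identity evaluates the coefficient. The normalisation with `(-y)^(δ𝔲)` rescales the `L`-vector
by `(-y)^(-β/2)`.
-/

section Multinomial

variable {σ : Type*} [DecidableEq σ]

@[to_additive]
theorem prod_apply_update {M : Type*} [CommMonoid M] {s : Finset σ} {j : σ} (hj : j ∈ s)
    (g : σ → ℕ → M) (a : σ → ℕ) (c : ℕ) :
    ∏ i ∈ s, g i (Function.update a j c i) = g j c * ∏ i ∈ s.erase j, g i (a i) := by
  rw [← Finset.mul_prod_erase s _ hj, Function.update_self]
  exact congrArg _ (Finset.prod_congr rfl fun i hi => by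
    rw [Function.update_of_ne (Finset.ne_of_mem_erase hi)])

theorem sum_update_pred_add_one {s : Finset σ} {a : σ → ℕ} {j : σ} (hj : j ∈ s) (ha : a j ≠ 0) :
    ∑ i ∈ s, Function.update a j (a j - 1) i + 1 = ∑ i ∈ s, a i := by
  rw [sum_apply_update hj (fun _ n => n), ← Finset.add_sum_erase s a hj]
  omega

theorem mul_prod_factorial_update_pred {s : Finset σ} {a : σ → ℕ} {j : σ} (hj : j ∈ s)
    (ha : a j ≠ 0) :
    a j * ∏ i ∈ s, (Function.update a j (a j - 1) i)! = ∏ i ∈ s, (a i)! := by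
  rw [prod_apply_update hj (fun _ n => n !), ← mul_assoc, Nat.mul_factorial_pred ha,
    Finset.mul_prod_erase s (fun i => (a i)!) hj]

theorem multinomial_eq_sum_update_pred {s : Finset σ} (hs : s.Nonempty) {a : σ → ℕ}
    (ha : ∀ j ∈ s, a j ≠ 0) :
    Nat.multinomial s a = ∑ j ∈ s, Nat.multinomial s (Function.update a j (a j - 1)) := by
  have hterm : ∀ j ∈ s, (∏ i ∈ s, (a i)!) * Nat.multinomial s (Function.update a j (a j - 1)) =
      a j * (∑ i ∈ s, a i - 1)! := fun j hj => by
    rw [← mul_prod_factorial_update_pred hj (ha j hj), mul_assoc, Nat.multinomial_spec,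
      ← sum_update_pred_add_one hj (ha j hj), Nat.add_sub_cancel]
  have hsum : ∑ j ∈ s, a j ≠ 0 := by
    obtain ⟨j, hj⟩ := hs
    exact fun h => ha j hj (Finset.sum_eq_zero_iff.1 h j hj)
  have hfac : 0 < ∏ i ∈ s, (a i)! := Finset.prod_pos fun i _ => (a i).factorial_pos
  refine Nat.eq_of_mul_eq_mul_left hfac ?_
  rw [Nat.multinomial_spec, Finset.mul_sum, Finset.sum_congr rfl hterm, ← Finset.sum_mul,
    Nat.mul_factorial_pred hsum]

theorem multinomial_erase_of_eq_zero {s : Finset σ} {a : σ → ℕ} {k : σ} (hk : k ∈ s)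
    (ha : a k = 0) : Nat.multinomial (s.erase k) a = Nat.multinomial s a := by
  conv_rhs => rw [← Finset.insert_erase hk, Nat.multinomial_insert (Finset.notMem_erase k s), ha,
    Nat.choose_zero_right, one_mul]

end Multinomial

section LeadingCoefficient

open MvPolynomial

variable {σ R : Type*} [CommRing R]

theorem degreeOf_mul_X_sub_X_le {k j : σ} (hjk : j ≠ k) (Q : MvPolynomial σ R) :
    degreeOf k (Q * (X k - X j)) ≤ degreeOf k Q + 1 := by
  rw [mul_sub]
  refine (degreeOf_sub_le _ _ _).trans (max_le (degreeOf_mul_X_self k Q) ?_)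
  exact (degreeOf_mul_X_of_ne Q hjk.symm).trans_le (Nat.le_succ _)

theorem coeff_add_single_mul_X_sub_X {k j : σ} (hjk : j ≠ k) {m : σ →₀ ℕ} (hm : m k = 0)
    {Q : MvPolynomial σ R} {d : ℕ} (hQ : degreeOf k Q ≤ d) :
    coeff (m + Finsupp.single k (d + 1)) (Q * (X k - X j)) = coeff (m + Finsupp.single k d) Q := by
  have hXj : coeff (m + Finsupp.single k (d + 1)) (Q * X j) = 0 := by
    by_contra h
    have hle := monomial_le_degreeOf k (mem_support_iff.2 h)
    rw [degreeOf_mul_X_of_ne Q hjk.symm, Finsupp.add_apply, hm, Finsupp.single_eq_same] at hle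
    omega
  rw [mul_sub, coeff_sub, hXj, sub_zero, Finsupp.single_add, ← add_assoc, coeff_mul_X]

theorem degreeOf_mul_prod_X_sub_X_le {ι : Type*} {k : σ} {f : ι → σ} {t : Finset ι}
    (hf : ∀ i ∈ t, f i ≠ k) (Q : MvPolynomial σ R) :
    degreeOf k (Q * ∏ i ∈ t, (X k - X (f i))) ≤ degreeOf k Q + t.card := by
  classical
  induction t using Finset.induction_on with
  | empty => simp
  | insert i t hi ih =>
    rw [Finset.prod_insert hi, mul_comm (X k - X (f i)), ← mul_assoc,
      Finset.card_insert_of_notMem hi]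
    have := ih fun i' hi' => hf i' (Finset.mem_insert_of_mem hi')
    have := degreeOf_mul_X_sub_X_le (hf i (Finset.mem_insert_self i t))
      (Q * ∏ i ∈ t, (X k - X (f i)))
    omega

theorem coeff_add_single_mul_prod_X_sub_X {ι : Type*} {k : σ} {f : ι → σ} {t : Finset ι}
    (hf : ∀ i ∈ t, f i ≠ k) {m : σ →₀ ℕ} (hm : m k = 0) {Q : MvPolynomial σ R}
    (hQ : degreeOf k Q = 0) :
    coeff (m + Finsupp.single k t.card) (Q * ∏ i ∈ t, (X k - X (f i))) = coeff m Q := by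
  classical
  induction t using Finset.induction_on with
  | empty => simp
  | insert i t hi ih =>
    have hft : ∀ i' ∈ t, f i' ≠ k := fun i' hi' => hf i' (Finset.mem_insert_of_mem hi')
    have hdeg := degreeOf_mul_prod_X_sub_X_le hft Q
    rw [hQ, zero_add] at hdeg
    rw [Finset.prod_insert hi, mul_comm (X k - X (f i)), ← mul_assoc,
      Finset.card_insert_of_notMem hi,
      coeff_add_single_mul_X_sub_X (hf i (Finset.mem_insert_self i t)) hm hdeg, ih hft]

theorem coeff_add_single_mul_prod_X_sub_X_pow {k : σ} {t : Finset σ} (hk : k ∉ t) (a : σ → ℕ)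
    {m : σ →₀ ℕ} (hm : m k = 0) {Q : MvPolynomial σ R} (hQ : degreeOf k Q = 0) :
    coeff (m + Finsupp.single k (∑ j ∈ t, a j)) (Q * ∏ j ∈ t, (X k - X j) ^ a j) = coeff m Q := by
  have h := coeff_add_single_mul_prod_X_sub_X (f := Sigma.fst)
    (t := t.sigma fun j => Finset.range (a j))
    (fun i hi => ne_of_mem_of_not_mem (Finset.mem_sigma.1 hi).1 hk) hm hQ
  simpa only [Finset.card_sigma, Finset.prod_sigma, Finset.prod_const, Finset.card_range] using h

end LeadingCoefficient

section Dyson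

open MvPolynomial

variable {σ R : Type*} [DecidableEq σ] [CommRing R]

/-- The polynomial `∏_{j ∈ s} ∏_{i ∈ s, i ≠ j} (X_i - X_j) ^ a_j`, i.e. the Laurent polynomial
`∏_{i ≠ j} (1 - X_j / X_i) ^ a_j` of Dyson's identity with its denominators cleared. -/
noncomputable def dysonPoly (R : Type*) [CommRing R] (s : Finset σ) (a : σ → ℕ) :
    MvPolynomial σ R :=
  ∏ j ∈ s, (∏ i ∈ s.erase j, (X i - X j)) ^ a j

/-- The exponent of the monomial of `dysonPoly R s a` that corresponds to the constant term of
Dyson's Laurent polynomial. -/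
noncomputable def dysonExponent (s : Finset σ) (a : σ → ℕ) : σ →₀ ℕ :=
  ∑ j ∈ s, a j • ∑ i ∈ s.erase j, Finsupp.single i 1

theorem dysonExponent_apply {s : Finset σ} {k : σ} (hk : k ∈ s) (a : σ → ℕ) :
    dysonExponent s a k = ∑ j ∈ s.erase k, a j := by
  simp only [dysonExponent, Finsupp.finsetSum_apply, Finsupp.smul_apply,
    Finsupp.single_apply, Finset.sum_ite_eq', smul_eq_mul, mul_ite, mul_one, mul_zero]
  rw [← Finset.sum_filter]
  congr 1
  ext j
  simp only [Finset.mem_filter, Finset.mem_erase, hk, and_true]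
  tauto

theorem dysonExponent_apply_of_notMem {s : Finset σ} {k : σ} (hk : k ∉ s) (a : σ → ℕ) :
    dysonExponent s a k = 0 := by
  simp [dysonExponent, Finsupp.finsetSum_apply, Finsupp.single_apply, hk]

theorem dysonExponent_eq_add_update_pred {s : Finset σ} {a : σ → ℕ} {j : σ} (hj : j ∈ s)
    (ha : a j ≠ 0) :
    dysonExponent s a =
      ∑ i ∈ s.erase j, Finsupp.single i 1 + dysonExponent s (Function.update a j (a j - 1)) := by
  rw [dysonExponent, dysonExponent,
    sum_apply_update hj (fun l n => n • ∑ i ∈ s.erase l, (Finsupp.single i 1 : σ →₀ ℕ)),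
    ← add_assoc, ← succ_nsmul', Nat.sub_add_cancel (Nat.one_le_iff_ne_zero.2 ha),
    Finset.add_sum_erase s (fun l => a l • ∑ i ∈ s.erase l, Finsupp.single i 1) hj]

theorem dysonExponent_of_eq_zero {s : Finset σ} {a : σ → ℕ} {k : σ} (hk : k ∈ s) (ha : a k = 0) :
    dysonExponent s a =
      dysonExponent (s.erase k) a + Finsupp.single k (∑ j ∈ s.erase k, a j) := by
  ext l
  rw [Finsupp.add_apply]
  by_cases hl : l ∈ s.erase k
  · rw [dysonExponent_apply (Finset.mem_of_mem_erase hl), dysonExponent_apply hl,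
      Finsupp.single_eq_of_ne (Finset.ne_of_mem_erase hl), add_zero, Finset.erase_right_comm,
      Finset.sum_erase _ ha]
  · rw [dysonExponent_apply_of_notMem hl, zero_add]
    rcases eq_or_ne l k with rfl | hlk
    · rw [dysonExponent_apply hk, Finsupp.single_eq_same]
    · rw [dysonExponent_apply_of_notMem fun h => hl (Finset.mem_erase.2 ⟨hlk, h⟩),
        Finsupp.single_eq_of_ne hlk]

theorem isHomogeneous_dysonPoly (s : Finset σ) (a : σ → ℕ) :
    (dysonPoly R s a).IsHomogeneous (dysonExponent s a).degree := by
  have hdegree : (dysonExponent s a).degree = ∑ j ∈ s, (∑ i ∈ s.erase j, 1) * a j := by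
    simp [dysonExponent, mul_comm]
  rw [hdegree]
  exact IsHomogeneous.prod _ _ _ fun j _ => (IsHomogeneous.prod _ _ _ fun i _ =>
    (isHomogeneous_X R i).sub (isHomogeneous_X R j)).pow _

theorem degreeOf_dysonPoly_of_notMem {s : Finset σ} {k : σ} (hk : k ∉ s) (a : σ → ℕ) :
    degreeOf k (dysonPoly R s a) = 0 := by
  have hX : ∀ i ∈ s, degreeOf k (X i : MvPolynomial σ R) = 0 := fun i hi =>
    degreeOf_X_of_ne (ne_of_mem_of_not_mem hi hk).symm
  have hsub : ∀ j ∈ s, ∀ i ∈ s.erase j, degreeOf k (X i - X j : MvPolynomial σ R) ≤ 0 :=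
    fun j hj i hi => (degreeOf_sub_le _ _ _).trans <| by
      rw [hX j hj, hX i (Finset.mem_of_mem_erase hi), max_self]
  refine Nat.le_zero.1 ((degreeOf_prod_le _ _ _).trans (Finset.sum_nonpos fun j hj => ?_))
  have hprod : degreeOf k (∏ i ∈ s.erase j, (X i - X j : MvPolynomial σ R)) ≤ 0 :=
    (degreeOf_prod_le _ _ _).trans (Finset.sum_nonpos (hsub j hj))
  exact (degreeOf_pow_le _ _ _).trans (by rw [Nat.le_zero.1 hprod, mul_zero])

theorem dysonPoly_of_eq_zero {s : Finset σ} {a : σ → ℕ} {k : σ} (hk : k ∈ s) (ha : a k = 0) :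
    dysonPoly R s a = dysonPoly R (s.erase k) a * ∏ j ∈ s.erase k, (X k - X j) ^ a j := by
  rw [dysonPoly, dysonPoly, ← Finset.mul_prod_erase s _ hk, ha, pow_zero, one_mul,
    ← Finset.prod_mul_distrib]
  refine Finset.prod_congr rfl fun j hj => ?_
  have hkj : k ∈ s.erase j := Finset.mem_erase.2 ⟨(Finset.ne_of_mem_erase hj).symm, hk⟩
  rw [← mul_pow, Finset.erase_right_comm, Finset.prod_erase_mul _ _ hkj]

-- Lagrange interpolation of the constant `1` at the nodes `v`, evaluated at zero.
theorem prod_prod_erase_sub_eq_sum_of_injOn {F : Type*} [Field F] {s : Finset σ} (hs : s.Nonempty)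
    {v : σ → F} (hv : Set.InjOn v s) :
    ∏ j ∈ s, ∏ i ∈ s.erase j, (v i - v j) =
      ∑ j ∈ s, (∏ i ∈ s.erase j, v i) * ∏ l ∈ s.erase j, ∏ i ∈ s.erase l, (v i - v l) := by
  have hbasis : ∀ j ∈ s, (∏ i ∈ s.erase j, (v i - v j)) * (Lagrange.basis s v j).eval 0 =
      ∏ i ∈ s.erase j, v i := fun j hj => by
    rw [Lagrange.basis, Polynomial.eval_prod, ← Finset.prod_mul_distrib]
    refine Finset.prod_congr rfl fun i hi => ?_
    have hne : v j - v i ≠ 0 := sub_ne_zero.2 fun h =>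
      Finset.ne_of_mem_erase hi (hv (Finset.mem_of_mem_erase hi) hj h.symm)
    simp only [Lagrange.basisDivisor, Polynomial.eval_mul, Polynomial.eval_C, Polynomial.eval_sub,
      Polynomial.eval_X]
    field_simp
    ring
  have hone : ∑ j ∈ s, (Lagrange.basis s v j).eval 0 = 1 := by
    rw [← Polynomial.eval_finsetSum, Lagrange.sum_basis hv hs, Polynomial.eval_one]
  rw [← mul_one (∏ j ∈ s, _), ← hone, Finset.mul_sum]
  refine Finset.sum_congr rfl fun j hj => ?_
  rw [← hbasis j hj, ← Finset.mul_prod_erase s _ hj, mul_right_comm]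

theorem prod_prod_erase_sub_eq_sum {s : Finset σ} (hs : s.Nonempty) (v : σ → R) :
    ∏ j ∈ s, ∏ i ∈ s.erase j, (v i - v j) =
      ∑ j ∈ s, (∏ i ∈ s.erase j, v i) * ∏ l ∈ s.erase j, ∏ i ∈ s.erase l, (v i - v l) := by
  have huniv : (∏ j ∈ s, ∏ i ∈ s.erase j, (X i - X j : MvPolynomial σ ℤ)) =
      ∑ j ∈ s, (∏ i ∈ s.erase j, X i) * ∏ l ∈ s.erase j, ∏ i ∈ s.erase l, (X i - X l) := by
    have hinj := IsFractionRing.injective (MvPolynomial σ ℤ) (FractionRing (MvPolynomial σ ℤ))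
    apply hinj
    simp only [map_prod, map_sum, map_mul, map_sub]
    exact prod_prod_erase_sub_eq_sum_of_injOn hs (hinj.comp X_injective).injOn
  simpa only [map_prod, map_sum, map_mul, map_sub, aeval_X] using congrArg (aeval v) huniv

theorem dysonPoly_eq_sum_update_pred {s : Finset σ} (hs : s.Nonempty) {a : σ → ℕ}
    (ha : ∀ j ∈ s, a j ≠ 0) :
    dysonPoly R s a = ∑ j ∈ s, monomial (∑ i ∈ s.erase j, Finsupp.single i 1) 1 *
      dysonPoly R s (Function.update a j (a j - 1)) := by
  set f : σ → MvPolynomial σ R := fun j => ∏ i ∈ s.erase j, (X i - X j) with hf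
  have hpow : ∀ j ∈ s, f j ^ a j = f j * f j ^ (a j - 1) := fun j hj =>
    (mul_pow_sub_one (ha j hj) _).symm
  have hfactor : dysonPoly R s a = (∏ j ∈ s, f j) * ∏ j ∈ s, f j ^ (a j - 1) := by
    rw [← Finset.prod_mul_distrib]
    exact Finset.prod_congr rfl hpow
  rw [hfactor, hf, prod_prod_erase_sub_eq_sum hs, ← hf, Finset.sum_mul]
  refine Finset.sum_congr rfl fun j hj => ?_
  rw [mul_assoc, monomial_sum_one, dysonPoly, prod_apply_update hj (fun l n => f l ^ n),
    ← Finset.mul_prod_erase s (fun l => f l ^ (a l - 1)) hj, mul_left_comm (Finset.prod _ f),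
    ← Finset.prod_mul_distrib]
  congr 2
  exact Finset.prod_congr rfl fun l hl => (hpow l (Finset.mem_of_mem_erase hl)).symm

-- Good's proof: both sides satisfy the same recursion and the same boundary conditions.
theorem coeff_dysonExponent_dysonPoly (s : Finset σ) (a : σ → ℕ) :
    coeff (dysonExponent s a) (dysonPoly R s a) = Nat.multinomial s a := by
  induction hn : s.card + ∑ j ∈ s, a j using Nat.strong_induction_on generalizing s a with
  | _ n ih =>
  subst hn
  rcases s.eq_empty_or_nonempty with rfl | hs
  · simp [dysonPoly, dysonExponent]
  by_cases hzero : ∃ k ∈ s, a k = 0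
  · obtain ⟨k, hk, hak⟩ := hzero
    have hlt : (s.erase k).card + ∑ j ∈ s.erase k, a j < s.card + ∑ j ∈ s, a j := by
      rw [Finset.sum_erase _ hak]
      exact Nat.add_lt_add_right (Finset.card_erase_lt_of_mem hk) _
    rw [dysonPoly_of_eq_zero hk hak, dysonExponent_of_eq_zero hk hak,
      coeff_add_single_mul_prod_X_sub_X_pow (Finset.notMem_erase k s) a
        (dysonExponent_apply_of_notMem (Finset.notMem_erase k s) a)
        (degreeOf_dysonPoly_of_notMem (Finset.notMem_erase k s) a),
      ih _ hlt _ _ rfl, multinomial_erase_of_eq_zero hk hak]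
  · push Not at hzero
    rw [dysonPoly_eq_sum_update_pred hs hzero, coeff_sum, multinomial_eq_sum_update_pred hs hzero,
      Nat.cast_sum]
    refine Finset.sum_congr rfl fun j hj => ?_
    have hlt := sum_update_pred_add_one hj (hzero j hj)
    rw [dysonExponent_eq_add_update_pred hj (hzero j hj), coeff_monomial_mul, one_mul,
      ih _ (by omega) _ _ rfl]

end Dyson

section ConfluentVandermonde

open Polynomial

variable {R : Type*} [CommRing R]

/-- The `l`-th divided derivative at `x` of the moment curve `x ↦ (1, x, …, x ^ (N - 1))`. -/
def osculatingVector (N : ℕ) (x : R) (l : ℕ) : Fin N → R :=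
  fun n => ((n : ℕ).choose l : R) * x ^ ((n : ℕ) - l)

theorem sum_osculatingVector_mul_coeff {N : ℕ} {p : R[X]} (hp : p.natDegree < N) (x : R) (l : ℕ) :
    ∑ n : Fin N, osculatingVector N x l n * p.coeff n = (taylor x p).coeff l := by
  conv_rhs => rw [p.as_sum_range_C_mul_X_pow' hp, map_sum, finsetSum_coeff, Finset.sum_range]
  refine Finset.sum_congr rfl fun n _ => ?_
  rw [taylor_mul, taylor_C, taylor_X_pow, coeff_C_mul, coeff_X_add_C_pow, osculatingVector]
  ring

/-- The confluent Vandermonde matrix of the nodes `x 0, …, x (K - 1)`, each of multiplicity `L`: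
row `L * i + l` is the `l`-th osculating vector at the node `x i`. -/
def confluentVandermonde (L K : ℕ) (x : ℕ → R) : Matrix (Fin (L * K)) (Fin (L * K)) R :=
  Matrix.of fun r => osculatingVector (L * K) (x (r / L)) (r % L)

/-- The Newton basis polynomial of degree `r` for the nodes `x 0, x 1, …`, each repeated
`L` times. -/
noncomputable def confluentNewton (L : ℕ) (x : ℕ → R) (r : ℕ) : R[X] :=
  (∏ i ∈ Finset.range (r / L), (X - C (x i)) ^ L) * (X - C (x (r / L))) ^ (r % L)

theorem monic_confluentNewton (L : ℕ) (x : ℕ → R) (r : ℕ) : (confluentNewton L x r).Monic :=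
  (monic_prod_of_monic _ _ fun i _ => (monic_X_sub_C (x i)).pow L).mul ((monic_X_sub_C _).pow _)

theorem natDegree_confluentNewton [Nontrivial R] (L : ℕ) (x : ℕ → R) (r : ℕ) :
    (confluentNewton L x r).natDegree = r := by
  have hpow (i : ℕ) : ((X - C (x i)) ^ L).Monic := (monic_X_sub_C (x i)).pow L
  rw [confluentNewton, (monic_prod_of_monic _ _ fun i _ => hpow i).natDegree_mul
    ((monic_X_sub_C _).pow _), natDegree_prod_of_monic _ _ fun i _ => hpow i]
  simp only [(monic_X_sub_C _).natDegree_pow, natDegree_X_sub_C, Finset.sum_const,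
    Finset.card_range, smul_eq_mul, mul_one]
  exact Nat.div_add_mod' r L

theorem coeff_taylor_X_sub_C_pow_mul (x : R) (q : R[X]) (e l : ℕ) :
    (taylor x ((X - C x) ^ e * q)).coeff l = if e ≤ l then (taylor x q).coeff (l - e) else 0 := by
  rw [taylor_mul, taylor_pow, map_sub, taylor_X, taylor_C, add_sub_cancel_right, coeff_X_pow_mul']

theorem coeff_taylor_confluentNewton_self (L : ℕ) (x : ℕ → R) (r : ℕ) :
    (taylor (x (r / L)) (confluentNewton L x r)).coeff (r % L) =
      ∏ i ∈ Finset.range (r / L), (x (r / L) - x i) ^ L := by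
  rw [confluentNewton, mul_comm, coeff_taylor_X_sub_C_pow_mul, if_pos le_rfl, Nat.sub_self,
    taylor_coeff_zero, eval_prod]
  simp only [eval_pow, eval_sub, eval_X, eval_C]

theorem coeff_taylor_confluentNewton_of_lt {L : ℕ} (hL : 0 < L) (x : ℕ → R) {r j : ℕ}
    (hrj : r < j) : (taylor (x (r / L)) (confluentNewton L x j)).coeff (r % L) = 0 := by
  rcases (Nat.div_le_div_right hrj.le : r / L ≤ j / L).lt_or_eq with hlt | heq
  · rw [confluentNewton, ← Finset.mul_prod_erase _ _ (Finset.mem_range.2 hlt), mul_assoc,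
      coeff_taylor_X_sub_C_pow_mul, if_neg (Nat.mod_lt _ hL).not_ge]
  · have hmod : r % L < j % L := by
      have hr := Nat.div_add_mod r L
      have hj := Nat.div_add_mod j L
      rw [← heq] at hj
      omega
    rw [confluentNewton, mul_comm (Finset.prod _ _), ← heq, coeff_taylor_X_sub_C_pow_mul,
      if_neg hmod.not_ge]

theorem prod_range_mul_comp_div {M : Type*} [CommMonoid M] (L K : ℕ) (f : ℕ → M) :
    ∏ r ∈ Finset.range (L * K), f (r / L) = ∏ i ∈ Finset.range K, f i ^ L := by
  induction K with
  | zero => simp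
  | succ K ih =>
    have hblock : ∀ l ∈ Finset.range L, f ((L * K + l) / L) = f K := fun l hl => by
      have hl := Finset.mem_range.1 hl
      rw [Nat.mul_add_div (Nat.zero_lt_of_lt hl), Nat.div_eq_of_lt hl, add_zero]
    rw [Nat.mul_succ, Finset.prod_range_add, ih, Finset.prod_range_succ,
      Finset.prod_congr rfl hblock, Finset.prod_const, Finset.card_range]

-- Multiplying by the unitriangular coefficient matrix of the Newton basis makes the matrix lower
-- triangular.
theorem det_confluentVandermonde (L K : ℕ) (x : ℕ → R) :
    (confluentVandermonde L K x).det =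
      ∏ k ∈ Finset.range K, ∏ i ∈ Finset.range k, (x k - x i) ^ L ^ 2 := by
  nontriviality R
  let newton : Matrix (Fin (L * K)) (Fin (L * K)) R :=
    Matrix.of fun n j => (confluentNewton L x j).coeff n
  have hnewton : newton.det = 1 :=
    Matrix.det_matrixOfPolynomials (fun j : Fin (L * K) => confluentNewton L x j)
      (fun j => natDegree_confluentNewton L x j) (fun j => monic_confluentNewton L x j)
  have hmul (r j : Fin (L * K)) : (confluentVandermonde L K x * newton) r j =
      (taylor (x (r / L)) (confluentNewton L x j)).coeff (r % L) :=
    sum_osculatingVector_mul_coeff ((natDegree_confluentNewton L x j).trans_lt j.2) _ _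
  have hlower : (confluentVandermonde L K x * newton).IsLowerTriangular := fun r j hrj => by
    rw [hmul]
    exact coeff_taylor_confluentNewton_of_lt (Nat.pos_of_mul_pos_right r.pos) x hrj
  calc (confluentVandermonde L K x).det
      = ∏ r : Fin (L * K), ∏ i ∈ Finset.range (r / L), (x (r / L) - x i) ^ L := by
        rw [← mul_one (confluentVandermonde L K x).det, ← hnewton, ← Matrix.det_mul,
          Matrix.det_of_isLowerTriangular _ hlower]
        exact Finset.prod_congr rfl fun r _ =>
          (hmul r r).trans (coeff_taylor_confluentNewton_self L x r)
    _ = ∏ k ∈ Finset.range K, (∏ i ∈ Finset.range k, (x k - x i) ^ L) ^ L := by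
        rw [Fin.prod_univ_eq_prod_range
          fun r => ∏ i ∈ Finset.range (r / L), (x (r / L) - x i) ^ L,
          prod_range_mul_comp_div L K fun k => ∏ i ∈ Finset.range k, (x k - x i) ^ L]
    _ = ∏ k ∈ Finset.range K, ∏ i ∈ Finset.range k, (x k - x i) ^ L ^ 2 := by
        simp only [← Finset.prod_pow, ← pow_mul, sq]

end ConfluentVandermonde

section Minors

variable {R : Type*} [CommRing R]

theorem det_vandermonde_natCast [IsDomain R] {n : ℕ} (v : Fin n → ℕ) :
    (Matrix.vandermonde fun i => (v i : R)).det =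
      (∏ i : Fin n, ((i : ℕ)! : R)) * (Matrix.of fun i j : Fin n => ((v i).choose j : R)).det := by
  rw [Matrix.det_eval_matrixOfPolynomials_eq_det_vandermonde _ (fun i : Fin n => descPochhammer R i)
    (fun i => descPochhammer_natDegree R i) (fun i => monic_descPochhammer R i),
    ← Matrix.det_mul_row]
  congr 1
  ext i j
  simp only [Matrix.of_apply]
  rw [descPochhammer_eval_eq_descFactorial, Nat.descFactorial_eq_factorial_mul_choose,
    Nat.cast_mul]

theorem det_choose_val (n : ℕ) :
    (Matrix.of fun i j : Fin n => ((i : ℕ).choose j : R)).det = 1 := by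
  rw [Matrix.det_of_isLowerTriangular]
  · simp
  · intro i j hij
    rw [Matrix.of_apply, Nat.choose_eq_zero_of_lt (show (i : ℕ) < j from hij), Nat.cast_zero]

theorem det_choose_mul_pow {n : ℕ} (v : Fin n → ℕ) (x : R) :
    (Matrix.of fun k l : Fin n => ((v k).choose l : R) * x ^ (v k - l)).det =
      x ^ (∑ k, v k - ∑ l : Fin n, (l : ℕ)) *
        (Matrix.of fun k l : Fin n => ((v k).choose l : R)).det := by
  rw [Matrix.det_apply, Matrix.det_apply, Finset.mul_sum]
  refine Finset.sum_congr rfl fun σ _ => ?_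
  rw [mul_smul_comm]
  congr 1
  simp only [Matrix.of_apply]
  by_cases h : ∀ l : Fin n, (l : ℕ) ≤ v (σ l)
  · rw [Finset.prod_mul_distrib, Finset.prod_pow_eq_pow_sum,
      Finset.sum_tsub_distrib _ fun l _ => h l, Equiv.sum_comp σ v, mul_comm]
  · push Not at h
    obtain ⟨l, hl⟩ := h
    have hchoose : ((v (σ l)).choose l : R) = 0 := by
      rw [Nat.choose_eq_zero_of_lt hl, Nat.cast_zero]
    rw [Finset.prod_eq_zero (Finset.mem_univ l) (by rw [hchoose, zero_mul]),
      Finset.prod_eq_zero (Finset.mem_univ l) hchoose, mul_zero]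

theorem normVandermonde_eq_det {N L : ℕ} (t : Set.powersetCard (Fin N) L) :
    normVandermonde t = (Matrix.of fun k l : Fin L =>
      (((Set.powersetCard.ofFinEmbEquiv.symm t k : ℕ).choose l : ℕ) : ℂ)).det := by
  have hvandermonde (v : Fin L → ℕ) : ∏ k, ∏ j ∈ Finset.Iio k, ((v k : ℂ) - v j) =
      (∏ i : Fin L, ((i : ℕ)! : ℂ)) * (Matrix.of fun k l : Fin L => ((v k).choose l : ℂ)).det := by
    rw [← det_vandermonde_natCast, Matrix.det_vandermonde]
    exact Finset.prod_comm' (by simp)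
  have hfac : (∏ i : Fin L, ((i : ℕ)! : ℂ)) ≠ 0 :=
    Finset.prod_ne_zero_iff.2 fun i _ => Nat.cast_ne_zero.2 (Nat.factorial_ne_zero _)
  simp only [normVandermonde, Finset.prod_div_distrib]
  rw [hvandermonde fun k => Set.powersetCard.ofFinEmbEquiv.symm t k, hvandermonde fun k => k,
    det_choose_val, mul_one, mul_div_cancel_left₀ _ hfac]

/-- The excess `Σ𝔱 - L (L - 1) / 2` of the element sum of `𝔱` over its least possible value; the
subtraction never truncates. -/
def excess {N L : ℕ} (t : Set.powersetCard (Fin N) L) : ℕ :=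
  ∑ k : Fin L, (Set.powersetCard.ofFinEmbEquiv.symm t k : ℕ) - ∑ l : Fin L, (l : ℕ)

theorem ιMulti_osculatingVector (N L : ℕ) (x : ℂ) :
    exteriorPower.ιMulti ℂ L (fun l : Fin L => osculatingVector N x l) =
      ∑ u : Set.powersetCard (Fin N) L, (x ^ excess u * normVandermonde u) • basisBlade u := by
  rw [← ((Pi.basisFun ℂ (Fin N)).exteriorPower L).sum_repr
    (exteriorPower.ιMulti ℂ L fun l : Fin L => osculatingVector N x l)]
  refine Finset.sum_congr rfl fun u _ => ?_
  rw [exteriorPower.basis_apply, exteriorPower.basis_repr_apply,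
    exteriorPower.ιMultiDual_apply_ιMulti, normVandermonde_eq_det, excess, ← det_choose_mul_pow,
    ← Matrix.det_transpose]
  rfl

end Minors

section Wedge

theorem volumeCoeff_ιMulti {N : ℕ} (w : Fin N → Fin N → ℂ) :
    volumeCoeff (ExteriorAlgebra.ιMulti ℂ N w) = (Matrix.of w).det := by
  let e := Pi.basisFun ℂ (Fin N)
  let f : (Fin N → ℂ) [⋀^Fin N]→ₗ[ℂ] ℂ :=
    (e.ExteriorAlgebra.coord Finset.univ).compAlternatingMap (ExteriorAlgebra.ιMulti ℂ N)
  have hcard : (Finset.univ : Finset (Fin N)).card = N := Finset.card_fin N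
  have hbasis : ExteriorAlgebra.ιMulti ℂ N e = e.ExteriorAlgebra Finset.univ := by
    have hid : Finset.orderEmbOfFin Finset.univ hcard = RelEmbedding.refl _ :=
      (Finset.orderEmbOfFin_unique' hcard fun _ => Finset.mem_univ _).symm
    rw [ExteriorAlgebra.basis_apply_ofCard e hcard, ExteriorAlgebra.ιMulti_family]
    congr 1
    funext i
    rw [Function.comp_apply, Set.powersetCard.ofFinEmbEquiv_symm_apply]
    exact congrArg e (DFunLike.congr_fun hid i).symm
  have hfe : f e = 1 := by simp [f, hbasis]
  calc volumeCoeff (ExteriorAlgebra.ιMulti ℂ N w) = (f e • e.det) w :=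
        DFunLike.congr_fun (f.eq_smul_basis_det e) w
    _ = (Matrix.of w).det := by
        rw [hfe, one_smul, Module.Basis.det_apply, ← Matrix.det_transpose]
        rfl

theorem prod_ofFn_ιMulti {R M : Type*} [CommRing R] [AddCommGroup M] [Module R M] (L K : ℕ)
    (w : ℕ → ℕ → M) :
    (List.ofFn fun i : Fin K => ExteriorAlgebra.ιMulti R L fun l : Fin L => w i l).prod =
      ExteriorAlgebra.ιMulti R (L * K) fun r : Fin (L * K) => w (r / L) (r % L) := by
  simp only [ExteriorAlgebra.ιMulti_apply]
  rw [List.ofFn_mul', List.prod_flatten, List.map_ofFn]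
  congr 2
  funext i
  simp only [Function.comp_apply]
  congr 2
  funext l
  rw [Nat.mul_add_div l.pos, Nat.div_eq_of_lt l.2, add_zero, Nat.mul_add_mod,
    Nat.mod_eq_of_lt l.2]

/-- The coefficient of the volume form in a product of `K` elements of the exterior algebra: the
polarisation of the hyperpfaffian. -/
noncomputable def volumeCoeffProd (N K : ℕ) :
    MultilinearMap ℂ (fun _ : Fin K => ExteriorAlgebra ℂ (Fin N → ℂ)) ℂ :=
  ((Pi.basisFun ℂ (Fin N)).ExteriorAlgebra.coord Finset.univ).compMultilinearMap
    (MultilinearMap.mkPiAlgebraFin ℂ K _)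

theorem volumeCoeffProd_apply {N K : ℕ} (α : Fin K → ExteriorAlgebra ℂ (Fin N → ℂ)) :
    volumeCoeffProd N K α = volumeCoeff (List.ofFn α).prod :=
  rfl

theorem hyperpfaffian_eq_volumeCoeffProd (L K : ℕ) (ω : ⋀[ℂ]^L (Fin (L * K) → ℂ)) :
    hyperpfaffian L K ω = (K ! : ℂ)⁻¹ * volumeCoeffProd (L * K) K fun _ => ω := by
  rw [volumeCoeffProd_apply, hyperpfaffian, volumeCoeff, map_smul, Finsupp.smul_apply, smul_eq_mul,
    List.ofFn_const, List.prod_replicate]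
  rfl

theorem hyperpfaffian_smul (L K : ℕ) (c : ℂ) (ω : ⋀[ℂ]^L (Fin (L * K) → ℂ)) :
    hyperpfaffian L K (c • ω) = c ^ K * hyperpfaffian L K ω := by
  have hsmul := (volumeCoeffProd (L * K) K).map_smul_univ (fun _ => c) fun _ => ω
  rw [Finset.prod_const, Finset.card_fin, smul_eq_mul] at hsmul
  rw [hyperpfaffian_eq_volumeCoeffProd, hyperpfaffian_eq_volumeCoeffProd, mul_left_comm, ← hsmul]
  rfl

theorem volumeCoeffProd_osculating (L K : ℕ) (x : Fin K → ℂ) :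
    volumeCoeffProd (L * K) K (fun i => exteriorPower.ιMulti ℂ L fun l : Fin L =>
        osculatingVector (L * K) (x i) l) =
      ∏ i, ∏ j ∈ Finset.Ioi i, (x j - x i) ^ L ^ 2 := by
  obtain ⟨x, rfl⟩ := (Fin.val_injective (n := K)).surjective_comp_right x
  simp only [volumeCoeffProd_apply, exteriorPower.ιMulti_apply_coe, Function.comp_apply]
  rw [prod_ofFn_ιMulti L K fun i l => osculatingVector (L * K) (x i) l, volumeCoeff_ιMulti]
  calc (confluentVandermonde L K x).det
      = ∏ j : Fin K, ∏ i ∈ Finset.Iio j, (x j - x i) ^ L ^ 2 := by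
        rw [det_confluentVandermonde, Finset.prod_range]
        refine Finset.prod_congr rfl fun j _ => ?_
        rw [← Nat.Iio_eq_range, ← Fin.map_valEmbedding_Iio, Finset.prod_map]
        rfl
    _ = ∏ i : Fin K, ∏ j ∈ Finset.Ioi i, (x j - x i) ^ L ^ 2 := Finset.prod_comm' (by simp)

end Wedge

section Coefficients

open MvPolynomial

variable {σ : Type*} [Fintype σ]

theorem coeff_prod_aeval_X {R : Type*} [CommSemiring R] (h : σ → Polynomial R) (m : σ →₀ ℕ) :
    coeff m (∏ i, Polynomial.aeval (X i : MvPolynomial σ R) (h i)) = ∏ i, (h i).coeff (m i) := by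
  classical
  have haeval (i : σ) : Polynomial.aeval (X i : MvPolynomial σ R) (h i) =
      ∑ n ∈ (h i).support, monomial (Finsupp.single i n) ((h i).coeff n) := by
    simp only [Polynomial.aeval_eq_sum_range, X_pow_eq_monomial, smul_monomial, smul_eq_mul,
      mul_one]
    refine (Finset.sum_subset (Polynomial.supp_subset_range_natDegree_succ) fun n _ hn => ?_).symm
    rw [Polynomial.notMem_support_iff.1 hn, monomial_zero]
  have hmonomial (p : σ → ℕ) : ∏ i, monomial (Finsupp.single i (p i)) ((h i).coeff (p i)) =
      monomial (Finsupp.equivFunOnFinite.symm p) (∏ i, (h i).coeff (p i)) := by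
    rw [Finsupp.equivFunOnFinite_symm_eq_sum, monomial_sum_index, map_prod,
      ← Finset.prod_mul_distrib]
    exact Finset.prod_congr rfl fun i _ => by rw [C_mul_monomial, mul_one]
  simp only [haeval, Finset.prod_univ_sum, hmonomial, coeff_sum, coeff_monomial,
    Equiv.symm_apply_eq]
  refine (Finset.sum_ite_eq' _ _ _).trans (ite_eq_left_iff.2 ?_)
  simp only [Fintype.mem_piFinset, not_forall, Polynomial.notMem_support_iff]
  rintro ⟨i, hi⟩
  exact (Finset.prod_eq_zero (Finset.mem_univ i) hi).symm

-- The argument in slot `i` is the coefficient of `x ^ m i` in the vector-valued polynomial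
-- `g(x) ∑ u, h_u(x) E_u`, and a multilinear map commutes with extracting coefficients slotwise.
theorem multilinearMap_sum_coeff_smul {U V F : Type*} [Fintype U] [CommRing F] [IsDomain F]
    [Infinite F] [AddCommGroup V] [Module F V] (T : MultilinearMap F (fun _ : σ => V) F)
    (E : U → V) (h : U → Polynomial F) {P : MvPolynomial σ F}
    (hP : ∀ x : σ → F, T (fun i => ∑ u, (h u).eval (x i) • E u) = eval x P)
    (g : Polynomial F) (m : σ →₀ ℕ) :
    T (fun i => ∑ u, (h u * g).coeff (m i) • E u) =
      coeff m (P * ∏ i, Polynomial.aeval (X i) g) := by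
  classical
  have hexpand (c : σ → U → F) : T (fun i => ∑ u, c i u • E u) =
      ∑ p : σ → U, T (fun i => E (p i)) * ∏ i, c i (p i) := by
    rw [T.map_sum]
    refine Finset.sum_congr rfl fun p _ => ?_
    rw [T.map_smul_univ (fun i => c i (p i)) fun i => E (p i), smul_eq_mul, mul_comm]
  have hP_expand : P = ∑ p : σ → U, C (T fun i => E (p i)) *
      ∏ i, Polynomial.aeval (X i) (h (p i)) := by
    refine MvPolynomial.funext fun x => ?_
    rw [← hP, hexpand]
    simp only [map_sum, map_mul, map_prod, ← coe_aeval_eq_eval, RingHom.coe_coe, aeval_C,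
      ← Polynomial.aeval_algHom_apply, aeval_X, Polynomial.coe_aeval_eq_eval,
      Algebra.algebraMap_self_apply]
  simp only [hexpand, hP_expand, Finset.sum_mul, coeff_sum, mul_assoc, coeff_C_mul,
    ← Finset.prod_mul_distrib, ← map_mul, coeff_prod_aeval_X]

end Coefficients

section DysonVandermonde

open MvPolynomial

variable {R : Type*} [CommRing R]

theorem dysonPoly_univ_const {n k : ℕ} (hk : Even k) :
    dysonPoly R (Finset.univ : Finset (Fin n)) (fun _ => k) =
      ∏ i, ∏ j ∈ Finset.Ioi i, (X j - X i) ^ (2 * k) := by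
  calc dysonPoly R (Finset.univ : Finset (Fin n)) (fun _ => k)
      = ∏ i, ∏ j ∈ {i}ᶜ, (X j - X i) ^ k := by
        simp only [dysonPoly, Finset.prod_pow, Finset.compl_singleton]
    _ = ∏ i, ∏ j ∈ Finset.Ioi i, (X j - X i) ^ k * (X i - X j) ^ k :=
        (Finset.prod_prod_Ioi_mul_eq_prod_prod_off_diag fun j i => (X j - X i) ^ k).symm
    _ = ∏ i, ∏ j ∈ Finset.Ioi i, (X j - X i) ^ (2 * k) := by
        refine Finset.prod_congr rfl fun i _ => Finset.prod_congr rfl fun j _ => ?_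
        rw [← neg_sub (X j), hk.neg_pow, ← pow_add, two_mul]

theorem coeff_eval_finSuccEquiv_of_isHomogeneous {n e : ℕ} {m : Fin n →₀ ℕ}
    {p : MvPolynomial (Fin (n + 1)) R} (hp : p.IsHomogeneous (m.cons e).degree) (y : R) :
    coeff m ((finSuccEquiv R n p).eval (C y)) = coeff (m.cons e) p * y ^ e := by
  have hterm (i : ℕ) : coeff m ((finSuccEquiv R n p).coeff i * C y ^ i) =
      coeff (m.cons i) p * y ^ i := by
    rw [← map_pow, mul_comm, coeff_C_mul, finSuccEquiv_coeff_coeff, mul_comm]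
  have hzero (i : ℕ) (hi : i ≠ e) : coeff (m.cons i) p = 0 := by
    refine hp.coeff_eq_zero fun hdeg => hi ?_
    simpa [Finsupp.degree_eq_sum, Fin.sum_univ_succ] using hdeg
  rw [Polynomial.eval_eq_sum, Polynomial.sum_def, coeff_sum]
  simp only [hterm]
  refine Finset.sum_eq_single e (fun i _ hi => by rw [hzero i hi, zero_mul]) fun he => ?_
  rw [← finSuccEquiv_coeff_coeff, Polynomial.notMem_support_iff.1 he, coeff_zero, zero_mul]

theorem coeff_vandermonde_pow_mul_prod_X_sub_C_pow {K k : ℕ} (hk : Even k) (y : R)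
    {m : Fin K →₀ ℕ} (hm : ∀ i, m i = K * k) :
    coeff m ((∏ i, ∏ j ∈ Finset.Ioi i, (X j - X i) ^ (2 * k)) * ∏ i, (X i - C y) ^ (2 * k)) =
      Nat.multinomial Finset.univ (fun _ : Fin (K + 1) => k) * y ^ (K * k) := by
  have hexponent : dysonExponent (Finset.univ : Finset (Fin (K + 1))) (fun _ => k) =
      m.cons (K * k) := by
    ext i
    rw [dysonExponent_apply (Finset.mem_univ i)]
    refine Fin.cases ?_ (fun i => ?_) i <;> simp [hm]
  have hspecialise :
      (finSuccEquiv R K (dysonPoly R (Finset.univ : Finset (Fin (K + 1))) fun _ => k)).eval (C y) =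
        (∏ i, ∏ j ∈ Finset.Ioi i, (X j - X i) ^ (2 * k)) * ∏ i, (X i - C y) ^ (2 * k) := by
    rw [dysonPoly_univ_const hk, Fin.prod_univ_succ, mul_comm]
    simp only [Fin.prod_Ioi_zero, Fin.prod_Ioi_succ, map_mul, map_prod, map_pow, map_sub,
      finSuccEquiv_X_zero, finSuccEquiv_X_succ, Polynomial.eval_mul, Polynomial.eval_prod,
      Polynomial.eval_pow, Polynomial.eval_sub, Polynomial.eval_X, Polynomial.eval_C]
  rw [← hspecialise, coeff_eval_finSuccEquiv_of_isHomogeneous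
    (hexponent ▸ isHomogeneous_dysonPoly _ _), ← hexponent, coeff_dysonExponent_dysonPoly]

end DysonVandermonde

section BinomialHyperpfaffian

theorem val_le_ofFinEmbEquiv_symm {N L : ℕ} (t : Set.powersetCard (Fin N) L) (k : Fin L) :
    (k : ℕ) ≤ Set.powersetCard.ofFinEmbEquiv.symm t k := by
  have hsubset : (Finset.Iio k).map (Set.powersetCard.ofFinEmbEquiv.symm t).toEmbedding ⊆
      Finset.Iio (Set.powersetCard.ofFinEmbEquiv.symm t k) := fun i hi => by
    obtain ⟨j, hj, rfl⟩ := Finset.mem_map.1 hi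
    exact Finset.mem_Iio.2
      ((Set.powersetCard.ofFinEmbEquiv.symm t).strictMono (Finset.mem_Iio.1 hj))
  simpa using Finset.card_le_card hsubset

theorem excess_add_sum_val {N L : ℕ} (t : Set.powersetCard (Fin N) L) :
    (excess t : ℤ) + ((∑ l : Fin L, (l : ℕ) : ℕ) : ℤ) = indexSum t := by
  rw [excess, ← Nat.cast_add,
    Nat.sub_add_cancel (Finset.sum_le_sum fun k _ => val_le_ofFinEmbEquiv_symm t k), indexSum,
    Nat.cast_sum]

theorem sq_eq_two_mul_half_sq {L : ℕ} (hLe : Even L) : L ^ 2 = 2 * (L ^ 2 / 2) :=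
  (Nat.mul_div_cancel' (dvd_pow hLe.two_dvd two_ne_zero)).symm

theorem even_half_sq {L : ℕ} (hLe : Even L) : Even (L ^ 2 / 2) := by
  have hdvd : 2 ^ 2 ∣ L ^ 2 := pow_dvd_pow_of_dvd hLe.two_dvd 2
  exact Nat.even_iff.2 (by omega)

theorem centredSum_add_half_sq {L : ℕ} (hLe : Even L) (K : ℕ)
    (t : Set.powersetCard (Fin (L * K)) L) :
    centredSum t + ((L ^ 2 / 2 : ℕ) : ℤ) =
      excess t + ((L ^ 2 : ℕ) : ℤ) - ((K * (L ^ 2 / 2) : ℕ) : ℤ) := by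
  obtain ⟨h, rfl⟩ := hLe
  have hsum : ((∑ l : Fin (h + h), (l : ℕ) : ℕ) : ℤ) = h * (2 * h - 1) := by
    have hgauss := Finset.sum_range_id_mul_two (h + h)
    rw [Finset.sum_range] at hgauss
    rcases Nat.eq_zero_or_pos h with rfl | hpos
    · simp
    · zify [show 1 ≤ h + h by omega] at hgauss
      push_cast
      linarith
  have hdiv : ((h + h : ℕ) : ℤ) * (((h + h) * K : ℕ) - 1) / 2 = h * (2 * h * K - 1) := by
    refine Int.ediv_eq_of_eq_mul_left two_ne_zero ?_
    push_cast
    ring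
  have hsq : (h + h) ^ 2 / 2 = 2 * h ^ 2 := by
    rw [show (h + h) ^ 2 = 2 * h ^ 2 * 2 by ring, Nat.mul_div_cancel _ two_pos]
  rw [centredSum, hdiv, ← excess_add_sum_val, hsum, hsq]
  push_cast
  ring

theorem coeff_X_pow_mul_X_sub_C_pow {F : Type*} [Field F] (y : F) {s b n : ℕ} {d : ℤ}
    (hd : d + b = s + (2 * b : ℕ) - n) :
    (Polynomial.X ^ s * (Polynomial.X - Polynomial.C y) ^ (2 * b)).coeff n =
      if |d| ≤ b then ((2 * b).choose (d + b).toNat : F) * (-y) ^ (d + b) else 0 := by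
  rw [Polynomial.coeff_X_pow_mul', sub_eq_add_neg, ← Polynomial.C_neg,
    Polynomial.coeff_X_add_C_pow]
  by_cases h : |d| ≤ b
  · obtain ⟨hneg, hpos⟩ := abs_le.1 h
    obtain ⟨e, he⟩ := Int.eq_ofNat_of_zero_le (show 0 ≤ d + b by omega)
    rw [if_pos h, if_pos (by omega), he, Int.toNat_natCast, zpow_natCast,
      show 2 * b - (n - s) = e by omega, mul_comm, ← Nat.choose_symm (show e ≤ 2 * b by omega),
      show 2 * b - e = n - s by omega]
  · rw [if_neg h, ite_eq_right_iff]
    intro hs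
    have hlt : 2 * b < n - s := by
      by_contra! hle
      exact h (abs_le.2 (by omega))
    rw [Nat.choose_eq_zero_of_lt hlt, Nat.cast_zero, mul_zero]

theorem volumeCoeffProd_sum_coeff {K L : ℕ} (g : Polynomial ℂ) (m : Fin K →₀ ℕ) :
    volumeCoeffProd (L * K) K (fun i => ∑ u : Set.powersetCard (Fin (L * K)) L,
        (Polynomial.X ^ excess u * g).coeff (m i) •
          normVandermonde u • (basisBlade u : ExteriorAlgebra ℂ (Fin (L * K) → ℂ))) =
      MvPolynomial.coeff m
        ((∏ i, ∏ j ∈ Finset.Ioi i, (MvPolynomial.X j - MvPolynomial.X i) ^ L ^ 2) *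
          ∏ i, Polynomial.aeval (MvPolynomial.X i) g) := by
  refine multilinearMap_sum_coeff_smul (volumeCoeffProd (L * K) K) _ _ (fun x => ?_) g m
  simp only [map_prod, map_pow, map_sub, MvPolynomial.eval_X]
  rw [← volumeCoeffProd_osculating]
  congr 1
  funext i
  rw [ιMulti_osculatingVector, AddSubmonoidClass.coe_finsetSum]
  simp only [Polynomial.eval_pow, Polynomial.eval_X, smul_smul, Submodule.coe_smul]

theorem sum_filter_smul_basisBlade_eq_sum_coeff {L : ℕ} (hLe : Even L) (K : ℕ) (y : ℂ) :
    ((∑ u : Set.powersetCard (Fin (L * K)) L with |centredSum u| ≤ ((L ^ 2 / 2 : ℕ) : ℤ),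
          (((L ^ 2).choose (centredSum u + ((L ^ 2 / 2 : ℕ) : ℤ)).toNat : ℂ) *
            (-y) ^ (centredSum u + ((L ^ 2 / 2 : ℕ) : ℤ)) * normVandermonde u) • basisBlade u :
        ⋀[ℂ]^L (Fin (L * K) → ℂ)) : ExteriorAlgebra ℂ (Fin (L * K) → ℂ)) =
      ∑ u : Set.powersetCard (Fin (L * K)) L,
        (Polynomial.X ^ excess u * (Polynomial.X - Polynomial.C y) ^ L ^ 2).coeff
          (K * (L ^ 2 / 2)) •
            normVandermonde u • (basisBlade u : ExteriorAlgebra ℂ (Fin (L * K) → ℂ)) := by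
  have hsq := sq_eq_two_mul_half_sq hLe
  rw [AddSubmonoidClass.coe_finsetSum, Finset.sum_filter]
  refine Finset.sum_congr rfl fun u _ => ?_
  have hcoeff := coeff_X_pow_mul_X_sub_C_pow y (d := centredSum u)
    (by rw [centredSum_add_half_sq hLe, ← hsq])
  rw [← hsq] at hcoeff
  rw [hcoeff, ite_smul, zero_smul, smul_smul, Submodule.coe_smul]

theorem hyperpfaffian_sum_choose_mul_zpow {L : ℕ} (hLe : Even L) (K : ℕ) (y : ℂ) :
    hyperpfaffian L K
        (∑ u : Set.powersetCard (Fin (L * K)) L with |centredSum u| ≤ ((L ^ 2 / 2 : ℕ) : ℤ),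
          (((L ^ 2).choose (centredSum u + ((L ^ 2 / 2 : ℕ) : ℤ)).toNat : ℂ) *
              (-y) ^ (centredSum u + ((L ^ 2 / 2 : ℕ) : ℤ)) * normVandermonde u) • basisBlade u) =
      1 / (K ! : ℂ) * (Nat.multinomial Finset.univ (fun _ : Fin (K + 1) => L ^ 2 / 2) : ℂ) *
        y ^ (K * (L ^ 2 / 2)) := by
  let m : Fin K →₀ ℕ := Finsupp.equivFunOnFinite.symm fun _ => K * (L ^ 2 / 2)
  have hdyson := coeff_vandermonde_pow_mul_prod_X_sub_C_pow (even_half_sq hLe) y (m := m)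
    fun _ => rfl
  have hcoeff := volumeCoeffProd_sum_coeff (L := L) ((Polynomial.X - Polynomial.C y) ^ L ^ 2) m
  simp only [map_pow, map_sub, Polynomial.aeval_X, Polynomial.aeval_C,
    MvPolynomial.algebraMap_eq] at hcoeff
  rw [← sq_eq_two_mul_half_sq hLe] at hdyson
  rw [hyperpfaffian_eq_volumeCoeffProd, sum_filter_smul_basisBlade_eq_sum_coeff hLe, one_div,
    mul_assoc, ← hdyson, ← hcoeff]
  rfl

theorem hyperpfaffian_sum_mul_zpow_add {L K : ℕ} {z : ℂ} (hz : z ≠ 0)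
    (s : Finset (Set.powersetCard (Fin (L * K)) L)) (c v : Set.powersetCard (Fin (L * K)) L → ℂ)
    (d : Set.powersetCard (Fin (L * K)) L → ℤ) (b : ℕ) :
    hyperpfaffian L K (∑ u ∈ s, (c u * z ^ (d u + b) * v u) • basisBlade u) =
      z ^ (K * b) * hyperpfaffian L K (∑ u ∈ s, (c u * z ^ d u * v u) • basisBlade u) := by
  rw [mul_comm K, pow_mul, ← hyperpfaffian_smul, Finset.smul_sum]
  congr 1
  refine Finset.sum_congr rfl fun u _ => ?_
  rw [smul_smul, zpow_add₀ hz, zpow_natCast]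
  congr 1
  ring

end BinomialHyperpfaffian

theorem mainTheorem5 (L M : ℕ) (hL : 0 < L) (hLe : Even L) (hM : 1 ≤ M) (y : ℂ) (hy : y ≠ 0) :
    hyperpfaffian L (M - 1)
        (∑ u : Set.powersetCard (Fin (L * (M - 1))) L with
            |centredSum u| ≤ ((L ^ 2 / 2 : ℕ) : ℤ),
          (((L ^ 2).choose (centredSum u + ((L ^ 2 / 2 : ℕ) : ℤ)).toNat : ℂ) *
              (-y) ^ (centredSum u) * normVandermonde u) • basisBlade u)
      = 1 / ((M - 1)! : ℂ) *
          (Nat.multinomial Finset.univ (fun _ : Fin M => L ^ 2 / 2) : ℂ) ∧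
    hyperpfaffian L (M - 1)
        (∑ u : Set.powersetCard (Fin (L * (M - 1))) L with
            |centredSum u| ≤ ((L ^ 2 / 2 : ℕ) : ℤ),
          (((L ^ 2).choose (centredSum u + ((L ^ 2 / 2 : ℕ) : ℤ)).toNat : ℂ) *
              (-y) ^ (centredSum u + ((L ^ 2 / 2 : ℕ) : ℤ)) * normVandermonde u) • basisBlade u)
      = 1 / ((M - 1)! : ℂ) *
          (Nat.multinomial Finset.univ (fun _ : Fin M => L ^ 2 / 2) : ℂ) *
          y ^ (L ^ 2 * (M - 1) / 2) := by
  generalize hK : M - 1 = K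
  obtain rfl : M = K + 1 := by omega
  have hshifted := hyperpfaffian_sum_choose_mul_zpow hLe K y
  have hexponent : L ^ 2 * K / 2 = K * (L ^ 2 / 2) := by
    rw [mul_comm, Nat.mul_div_assoc _ ⟨_, sq_eq_two_mul_half_sq hLe⟩]
  have hz : -y ≠ 0 := neg_ne_zero.2 hy
  refine ⟨mul_left_cancel₀ (pow_ne_zero (K * (L ^ 2 / 2)) hz) ?_, hexponent ▸ hshifted⟩
  rw [← hyperpfaffian_sum_mul_zpow_add hz, hshifted, ((even_half_sq hLe).mul_left K).neg_pow,
    mul_comm]
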